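/- All systems are finite-dimensional and non-zero. A quantum channel $\mathcal N\in\mathrm{CPTP}(A\to B)$ is a completely positive trace-preserving map. A superchannel $\Theta[\mathcal N]=\mathcal E^{RB\to B}\circ(\mathrm{id}_R\otimes\mathcal N)\circ\mathcal V^{A'\to RA}$ ($\mathcal V$ an isometry channel, $\mathcal E$ a channel) is *mixing* if, for all systems $C_0,C_1$, $\Theta\otimes\mathbb 1^{(C_0\to C_1)}$ maps every channel $\mathcal N^{AC_0\to BC_1}$ of the form $\mathcal N=\mathbf u^B\otimes \mathrm{Tr}_B\circ\mathcal N$ ($\mathbf u^B$ the uniform state) to a channel of the same form. For channels with the same output system, $\mathcal N\succ\mathcal M$ means $\mathcal M=\Theta[\mathcal N]$ for some mixing superchannel $\Theta$; for different output dimensions, the smaller output system is first embedded into the larger one by some isometry channel. A *channel entropy* is a real-valued function $\mathbb H$ on all quantum channels, not identically zero, with $\mathbb H(\mathcal N)\le\mathbb H(\mathcal M)$ whenever $\mathcal N\succ\mathcal M$, and $\mathbb H(\mathcal N\otimes\mathcal M)=\mathbb H(\mathcal N)+\mathbb H(\mathcal M)$. A classical channel $\mathcal N^{X\to Y}$ is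 given by probability vectors $\mathbf p_x$ on $Y$, $x\in X$, and is identified with the quantum channel $\rho\mapsto\sum_x\rho_{xx}\,\mathrm{diag}(\mathbf p_x)$; a probability vector is a classical channel with one-element input. Among classical channels with the same output, $\mathcal N\succ\mathcal M$ means $\mathcal M=\mathcal D\circ\mathcal N\circ\mathcal S$ with a classical channel $\mathcal S^{X'\to XZ}$ and a classical channel $\mathcal D^{YZ\to Y}$ that is doubly stochastic for each value $z$ of $Z$; outputs of different sizes are treated by padding with zeros. A *classical channel entropy* is a not identically zero real-valued function on all classical channels that is monotone (in the above sense) and additive. Let $H(\mathbf p)=-\sum_y p_y\log_2p_y$, and $$\underline H(\mathcal N)=\sup\{H(\mathbf q):\mathbf q\succ\mathcal N\},\qquad \overline H(\mathcal N)=\inf\{H(\mathbf q):\mathcal N\succ\mathbf q\},$$ where $\mathbf q$ runs over the probability vectors of arbitrary finite length. **Theorem.** For every classical channel $\mathcal N$ the two sets above are non-empty and, respectively, bounded above and below; the limit $\underline H^{\rm reg}(\mathcal N)=\lim_{k\to\infty}\frac1k\underline H(\mathcal N^{\otimes k})$ exists, and $$\underline H^{\rm reg}(\mathcal N)=\overline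 H(\mathcal N)=\min_{x}H(\mathbf p_x).$$ Every channel entropy $\mathbb H$ that reduces to the Shannon entropy $H$ on probability vectors satisfies $\mathbb H(\mathcal N)=\min_xH(\mathbf p_x)$ for every classical channel $\mathcal N$. Moreover, a function on classical channels is a classical channel entropy that reduces to $H$ on probability vectors if and only if it is $\mathcal N\mapsto\min_xH(\mathbf p_x)$; so there is exactly one such extension of the Shannon entropy to classical channels. -/

import Mathlib

open Filter Topology
open scoped Matrix ComplexOrder

noncomputable section

/-! ### Classical channels -/

/-- A classical channel `X → Y`: for every input `x` a probability vector `prob x` on `Y`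
(the column `p_x` of the transition matrix). A probability vector on `Y` is a channel
`Unit → Y`. -/
@[ext]
structure ClassicalChannel (X Y : Type) [Fintype Y] where
  prob : X → Y → ℝ
  nonneg : ∀ x y, 0 ≤ prob x y
  sum_eq_one : ∀ x, ∑ y, prob x y = 1

namespace ClassicalChannel

/-- Parallel use of two channels. -/
def tensor {X Y X' Y' : Type} [Fintype Y] [Fintype Y']
    (N : ClassicalChannel X Y) (M : ClassicalChannel X' Y') :
    ClassicalChannel (X × X') (Y × Y') where
  prob x y := N.prob x.1 y.1 * M.prob x.2 y.2
  nonneg x y := mul_nonneg (N.nonneg _ _) (M.nonneg _ _)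
  sum_eq_one x := by
    rw [Fintype.sum_prod_type, ← Fintype.sum_mul_sum, N.sum_eq_one, M.sum_eq_one, one_mul]

/-- The `k`-fold tensor power: `k` parallel uses of the channel. -/
def power {X Y : Type} [Fintype Y] (N : ClassicalChannel X Y) (k : ℕ) :
    ClassicalChannel (Fin k → X) (Fin k → Y) where
  prob x y := ∏ i, N.prob (x i) (y i)
  nonneg x y := Finset.prod_nonneg fun i _ => N.nonneg _ _
  sum_eq_one x := by
    classical
    have h := Finset.prod_univ_sum (fun _ : Fin k => (Finset.univ : Finset Y))
      (fun i y => N.prob (x i) y)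
    rw [Fintype.piFinset_univ] at h
    rw [← h]
    exact Finset.prod_eq_one fun i _ => N.sum_eq_one _

open Classical in
/-- Post-processing by an embedding `e` of the output system into a larger one (padding
the output vectors with zeros): the classical isometry channels. -/
def embed {X Y Y' : Type} [Fintype Y] [Fintype Y'] (N : ClassicalChannel X Y) (e : Y ↪ Y') :
    ClassicalChannel X Y' where
  prob x y' := ∑ y, if e y = y' then N.prob x y else 0
  nonneg x y' := Finset.sum_nonneg fun y _ => by
    split_ifs
    · exact N.nonneg _ _
    · exact le_rfl
  sum_eq_one x := by
    rw [Finset.sum_comm]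
    simp [N.sum_eq_one]

open Classical in
/-- `M` arises from `N` (same output system) by a random permutation superchannel
`M = D ∘ N ∘ S`: the input of `M` is pre-processed by a channel `S : X' → X × Z`, and the
output of `N` by the doubly stochastic matrix `D z`, conditioned on the classical message `z`. -/
def MajorizesSame {X X' Y : Type} [Fintype X] [Fintype Y]
    (N : ClassicalChannel X Y) (M : ClassicalChannel X' Y) : Prop :=
  ∃ (Z : Type) (_ : Fintype Z) (S : ClassicalChannel X' (X × Z)) (D : Z → Matrix Y Y ℝ),
    (∀ z, D z ∈ doublyStochastic ℝ Y) ∧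
    ∀ w y, M.prob w y = ∑ x, ∑ z, S.prob w (x, z) * (D z *ᵥ N.prob x) y

/-- Channel majorization `N ≻ M` for classical channels, where the smaller output system
is embedded into the larger one. -/
def Majorizes {X Y X' Y' : Type} [Fintype X] [Fintype Y] [Fintype Y']
    (N : ClassicalChannel X Y) (M : ClassicalChannel X' Y') : Prop :=
  (Fintype.card Y' < Fintype.card Y ∧ ∃ e : Y' ↪ Y, N.MajorizesSame (M.embed e)) ∨
  (Fintype.card Y ≤ Fintype.card Y' ∧ ∃ e : Y ↪ Y', (N.embed e).MajorizesSame M)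

end ClassicalChannel

/-- Shannon entropy in bits. -/
def shannonEntropy {Y : Type} [Fintype Y] (p : Y → ℝ) : ℝ :=
  -∑ y, p y * Real.logb 2 (p y)

/-- Real-valued functions on all classical channels between finite non-empty systems. -/
abbrev ClassicalChannelFunction : Type 1 :=
  ∀ (X Y : Type) [Fintype X] [Nonempty X] [Fintype Y], ClassicalChannel X Y → ℝ

/-- Channel entropies on the classical domain: non-zero, monotone under channel
majorization, additive under tensor products. -/
structure IsClassicalChannelEntropy (H : ClassicalChannelFunction) : Prop where
  nonzero : ∃ (X Y : Type) (_ : Fintype X) (_ : Nonempty X) (_ : Fintype Y)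
    (N : ClassicalChannel X Y), H X Y N ≠ 0
  monotone : ∀ (X Y X' Y' : Type) [Fintype X] [Nonempty X] [Fintype Y]
    [Fintype X'] [Nonempty X'] [Fintype Y']
    (N : ClassicalChannel X Y) (M : ClassicalChannel X' Y'),
    N.Majorizes M → H X Y N ≤ H X' Y' M
  additive : ∀ (X Y X' Y' : Type) [Fintype X] [Nonempty X] [Fintype Y]
    [Fintype X'] [Nonempty X'] [Fintype Y']
    (N : ClassicalChannel X Y) (M : ClassicalChannel X' Y'),
    H (X × X') (Y × Y') (N.tensor M) = H X Y N + H X' Y' M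

/-- `min_x H(p_x)`, as a function on classical channels. -/
def minOutputEntropy : ClassicalChannelFunction := fun X _ _ _ _ N =>
  (Finset.univ : Finset X).inf' Finset.univ_nonempty fun x => shannonEntropy (N.prob x)

/-- The values `H(q)` over probability vectors `q` of arbitrary finite length, `q ≻ N`. -/
def minExtensionSet {X Y : Type} [Fintype Y] (N : ClassicalChannel X Y) : Set ℝ :=
  {h | ∃ (n : ℕ) (q : ClassicalChannel Unit (Fin n)),
    q.Majorizes N ∧ h = shannonEntropy (q.prob ())}

/-- The values `H(q)` over probability vectors `q` of arbitrary finite length, `N ≻ q`. -/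
def maxExtensionSet {X Y : Type} [Fintype X] [Fintype Y] (N : ClassicalChannel X Y) : Set ℝ :=
  {h | ∃ (n : ℕ) (q : ClassicalChannel Unit (Fin n)),
    N.Majorizes q ∧ h = shannonEntropy (q.prob ())}

/-- The minimal extension of Shannon entropy to classical channels. -/
def minExtension {X Y : Type} [Fintype Y] (N : ClassicalChannel X Y) : ℝ :=
  sSup (minExtensionSet N)

/-- The maximal extension of Shannon entropy to classical channels. -/
def maxExtension {X Y : Type} [Fintype X] [Fintype Y] (N : ClassicalChannel X Y) : ℝ :=
  sInf (maxExtensionSet N)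

/-! ### Quantum channels -/

/-- `id_R ⊗ Φ`, acting blockwise. -/
def idTensor (R : Type) {A B : Type} (Φ : Matrix A A ℂ →ₗ[ℂ] Matrix B B ℂ) :
    Matrix (R × A) (R × A) ℂ →ₗ[ℂ] Matrix (R × B) (R × B) ℂ where
  toFun ρ := Matrix.of fun i j => Φ (Matrix.of fun a a' => ρ (i.1, a) (j.1, a')) i.2 j.2
  map_add' ρ σ := by
    ext i j
    exact congrFun (congrFun (map_add Φ (Matrix.of fun a a' => ρ (i.1, a) (j.1, a'))
      (Matrix.of fun a a' => σ (i.1, a) (j.1, a'))) i.2) j.2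
  map_smul' c ρ := by
    ext i j
    exact congrFun (congrFun (map_smul Φ c
      (Matrix.of fun a a' => ρ (i.1, a) (j.1, a'))) i.2) j.2

/-- `Φ ⊗ id_C`, acting blockwise. -/
def tensorId (C : Type) {A B : Type} (Φ : Matrix A A ℂ →ₗ[ℂ] Matrix B B ℂ) :
    Matrix (A × C) (A × C) ℂ →ₗ[ℂ] Matrix (B × C) (B × C) ℂ where
  toFun ρ := Matrix.of fun i j => Φ (Matrix.of fun a a' => ρ (a, i.2) (a', j.2)) i.1 j.1
  map_add' ρ σ := by
    ext i j
    exact congrFun (congrFun (map_add Φ (Matrix.of fun a a' => ρ (a, i.2) (a', j.2))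
      (Matrix.of fun a a' => σ (a, i.2) (a', j.2))) i.1) j.1
  map_smul' c ρ := by
    ext i j
    exact congrFun (congrFun (map_smul Φ c
      (Matrix.of fun a a' => ρ (a, i.2) (a', j.2))) i.1) j.1

/-- A quantum channel `A → B` between finite-dimensional systems (with bases indexed by
`A` and `B`): a completely positive, trace-preserving linear map. -/
structure QuantumChannel (A B : Type) [Fintype A] [Fintype B] where
  map : Matrix A A ℂ →ₗ[ℂ] Matrix B B ℂ
  completelyPositive : ∀ (R : Type) [Fintype R] (ρ : Matrix (R × A) (R × A) ℂ),
    ρ.PosSemidef → (idTensor R map ρ).PosSemidef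
  tracePreserving : ∀ ρ : Matrix A A ℂ, (map ρ).trace = ρ.trace

/-- `ρ ↦ V ρ V†`. -/
def conjMap {A B : Type} [Fintype A] (V : Matrix B A ℂ) :
    Matrix A A ℂ →ₗ[ℂ] Matrix B B ℂ where
  toFun ρ := V * ρ * Vᴴ
  map_add' ρ σ := by rw [Matrix.mul_add, Matrix.add_mul]
  map_smul' c ρ := by simp

open Classical in
/-- `V` is an isometry, so that `conjMap V` is an isometry channel. -/
def IsIsometryMatrix {A B : Type} [Fintype B] (V : Matrix B A ℂ) : Prop :=
  Vᴴ * V = 1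

namespace QuantumChannel

/-- The tensor product of two channels, `(N ⊗ id) ∘ (id ⊗ M)`. -/
def tensor {A B A' B' : Type} [Fintype A] [Fintype B] [Fintype A'] [Fintype B']
    (N : QuantumChannel A B) (M : QuantumChannel A' B') :
    QuantumChannel (A × A') (B × B') where
  map := tensorId B' N.map ∘ₗ idTensor A M.map
  completelyPositive R _ ρ hρ := by
    have h1 := (M.completelyPositive (R × A) _
      (hρ.submatrix (Equiv.prodAssoc R A A'))).submatrix
      (fun i : (R × B') × A => ((i.1.1, i.2), i.1.2))
    have h2 := (N.completelyPositive (R × B') _ h1).submatrix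
      (fun i : R × (B × B') => ((i.1, i.2.2), i.2.1))
    exact h2
  tracePreserving ρ := by
    have h1 : ∀ σ : Matrix (A × B') (A × B') ℂ, (tensorId B' N.map σ).trace = σ.trace := by
      intro σ
      simp only [Matrix.trace, Matrix.diag, Fintype.sum_prod_type_right]
      exact Finset.sum_congr rfl fun c _ =>
        N.tracePreserving (Matrix.of fun a a' => σ (a, c) (a', c))
    have h2 : (idTensor A M.map ρ).trace = ρ.trace := by
      simp only [Matrix.trace, Matrix.diag, Fintype.sum_prod_type]
      exact Finset.sum_congr rfl fun c _ =>
        M.tracePreserving (Matrix.of fun a a' => ρ (c, a) (c, a'))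
    rw [LinearMap.comp_apply, h1, h2]

end QuantumChannel

/-- A superchannel from channels `A → B` to channels `A' → B`, realized by a
pre-processing isometry `A' → R A` and a post-processing channel `R B → B`. -/
structure Superchannel (A B A' : Type) [Fintype A] [Fintype B] [Fintype A'] where
  R : Type
  [fintypeR : Fintype R]
  V : Matrix (R × A) A' ℂ
  isometry : IsIsometryMatrix V
  E : QuantumChannel (R × B) B

attribute [instance] Superchannel.fintypeR

open Classical in
/-- `N` on `A C₀ → B C₁` is marginally uniform with respect to `B`: `N = u_B ⊗ Tr_B N`. -/
def MarginallyUniform {A₀ B C₁ : Type} [Fintype B]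
    (N : Matrix A₀ A₀ ℂ →ₗ[ℂ] Matrix (B × C₁) (B × C₁) ℂ) : Prop :=
  ∀ ρ b c b' c', N ρ (b, c) (b', c') =
    if b = b' then (Fintype.card B : ℂ)⁻¹ * ∑ d, N ρ (d, c) (d, c') else 0

namespace Superchannel

variable {A B A' : Type} [Fintype A] [Fintype B] [Fintype A']

/-- `Θ[N] = E ∘ (id_R ⊗ N) ∘ V`. -/
def apply (Θ : Superchannel A B A') (N : Matrix A A ℂ →ₗ[ℂ] Matrix B B ℂ) :
    Matrix A' A' ℂ →ₗ[ℂ] Matrix B B ℂ :=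
  Θ.E.map ∘ₗ idTensor Θ.R N ∘ₗ conjMap Θ.V

/-- `(Θ ⊗ 1)[N]` for a channel `N` on `A C₀ → B C₁`, where `1` is the identity
superchannel on `C₀ → C₁`. -/
def applyExt (Θ : Superchannel A B A') {C₀ C₁ : Type}
    (N : Matrix (A × C₀) (A × C₀) ℂ →ₗ[ℂ] Matrix (B × C₁) (B × C₁) ℂ) :
    Matrix (A' × C₀) (A' × C₀) ℂ →ₗ[ℂ] Matrix (B × C₁) (B × C₁) ℂ :=
  tensorId C₁ Θ.E.map ∘ₗ
  (Matrix.reindexLinearEquiv ℂ ℂ (Equiv.prodAssoc Θ.R B C₁).symm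
    (Equiv.prodAssoc Θ.R B C₁).symm).toLinearMap ∘ₗ
  idTensor Θ.R N ∘ₗ
  (Matrix.reindexLinearEquiv ℂ ℂ (Equiv.prodAssoc Θ.R A C₀)
    (Equiv.prodAssoc Θ.R A C₀)).toLinearMap ∘ₗ
  tensorId C₀ (conjMap Θ.V)

/-- Mixing superchannels: `Θ` is completely uniformity-preserving. -/
def IsMixing (Θ : Superchannel A B A') : Prop :=
  ∀ (C₀ C₁ : Type) [Fintype C₀] [Nonempty C₀] [Fintype C₁] [Nonempty C₁]
    (N : QuantumChannel (A × C₀) (B × C₁)),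
    MarginallyUniform N.map → MarginallyUniform (Θ.applyExt N.map)

end Superchannel

/-- Majorization of quantum channels with the same output system. -/
def QuantumMajorizesSame {A A' B : Type} [Fintype A] [Fintype A'] [Fintype B]
    (N : Matrix A A ℂ →ₗ[ℂ] Matrix B B ℂ) (M : Matrix A' A' ℂ →ₗ[ℂ] Matrix B B ℂ) : Prop :=
  ∃ Θ : Superchannel A B A', Θ.IsMixing ∧ M = Θ.apply N

/-- Channel majorization `N ≻ M` for quantum channels, where the smaller output system is
embedded into the larger one by an isometry channel. -/
def QuantumChannel.Majorizes {A B A' B' : Type} [Fintype A] [Fintype B]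
    [Fintype A'] [Fintype B'] (N : QuantumChannel A B) (M : QuantumChannel A' B') : Prop :=
  (Fintype.card B' < Fintype.card B ∧ ∃ U : Matrix B B' ℂ, IsIsometryMatrix U ∧
    QuantumMajorizesSame N.map (conjMap U ∘ₗ M.map)) ∨
  (Fintype.card B ≤ Fintype.card B' ∧ ∃ U : Matrix B' B ℂ, IsIsometryMatrix U ∧
    QuantumMajorizesSame (conjMap U ∘ₗ N.map) M.map)

/-- Real-valued functions on all quantum channels between finite-dimensional non-zero
systems. -/
abbrev QuantumChannelFunction : Type 1 :=
  ∀ (A B : Type) [Fintype A] [Nonempty A] [Fintype B], QuantumChannel A B → ℝ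

/-- Channel entropies: non-zero, monotone under channel majorization, additive under
tensor products. -/
structure IsChannelEntropy (H : QuantumChannelFunction) : Prop where
  nonzero : ∃ (A B : Type) (_ : Fintype A) (_ : Nonempty A) (_ : Fintype B)
    (N : QuantumChannel A B), H A B N ≠ 0
  monotone : ∀ (A B A' B' : Type) [Fintype A] [Nonempty A] [Fintype B]
    [Fintype A'] [Nonempty A'] [Fintype B']
    (N : QuantumChannel A B) (M : QuantumChannel A' B'),
    N.Majorizes M → H A B N ≤ H A' B' M
  additive : ∀ (A B A' B' : Type) [Fintype A] [Nonempty A] [Fintype B]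
    [Fintype A'] [Nonempty A'] [Fintype B']
    (N : QuantumChannel A B) (M : QuantumChannel A' B'),
    H (A × A') (B × B') (N.tensor M) = H A B N + H A' B' M

open Classical in
/-- The linear map `ρ ↦ ∑ x, ρ x x • diag(p_x)`. -/
def ClassicalChannel.toLinearMap {X Y : Type} [Fintype X] [Fintype Y]
    (N : ClassicalChannel X Y) : Matrix X X ℂ →ₗ[ℂ] Matrix Y Y ℂ where
  toFun ρ := Matrix.diagonal fun y => ∑ x, ρ x x * (N.prob x y : ℂ)
  map_add' ρ σ := by
    rw [Matrix.diagonal_add]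
    simp only [Matrix.add_apply, add_mul, Finset.sum_add_distrib]
  map_smul' c ρ := by
    rw [← Matrix.diagonal_smul]
    congr 1
    funext y
    simp only [Matrix.smul_apply, smul_eq_mul, mul_assoc, RingHom.id_apply, Pi.smul_apply,
      Finset.mul_sum]

open Classical in
/-- A classical channel as a quantum channel, `ρ ↦ ∑ x, ρ x x • diag(p_x)`; in particular
a probability vector as a diagonal density matrix. -/
def ClassicalChannel.toQuantum {X Y : Type} [Fintype X] [Fintype Y]
    (N : ClassicalChannel X Y) : QuantumChannel X Y where
  map := N.toLinearMap
  completelyPositive R _ ρ hρ := by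
    have key : idTensor R N.toLinearMap ρ = ∑ y₀ : Y, ∑ x : X,
        (N.prob x y₀ : ℂ) • ((Matrix.diagonal fun i : R × Y => if i.2 = y₀ then (1 : ℂ) else 0)ᴴ
          * ρ.submatrix (fun i : R × Y => (i.1, x)) (fun i : R × Y => (i.1, x))
          * (Matrix.diagonal fun i : R × Y => if i.2 = y₀ then (1 : ℂ) else 0)) := by
      ext i j
      simp only [Matrix.sum_apply, Matrix.smul_apply, Matrix.diagonal_conjTranspose,
        Matrix.mul_diagonal, Matrix.diagonal_mul, idTensor, toLinearMap, LinearMap.coe_mk, AddHom.coe_mk,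
        Matrix.of_apply, Matrix.submatrix_apply, Matrix.diagonal_apply, smul_eq_mul]
      rw [Finset.sum_eq_single i.2]
      · by_cases h : i.2 = j.2
        · simp [h, mul_comm]
        · simp [h, Ne.symm h]
      · intro y _ hy
        simp [hy.symm]
      · simp
    rw [key]
    refine Matrix.posSemidef_sum _ fun y₀ _ => Matrix.posSemidef_sum _ fun x _ => ?_
    exact ((hρ.submatrix _).conjTranspose_mul_mul_same _).smul
      (by exact_mod_cast N.nonneg x y₀)
  tracePreserving ρ := by
    simp only [toLinearMap, LinearMap.coe_mk, AddHom.coe_mk, Matrix.trace_diagonal]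
    rw [Finset.sum_comm]
    refine Finset.sum_congr rfl fun x _ => ?_
    rw [← Finset.mul_sum]
    have := N.sum_eq_one x
    rw [← Complex.ofReal_sum, this]
    simp [Matrix.diag]

end

/-! Any entropy `H` extending Shannon's is squeezed between two comparisons with probability
vectors. From above, a channel majorizes each of its columns, so `H N ≤ min_x H(p_x)`. From below,
`H (N.power k) = k * H N` is at least the entropy of every vector that majorizes `N.power k`, so it
suffices to find such vectors with entropy close to `k * min_x H(p_x)`.

For `c < min_x H(p_x)`, a Chernoff bound shows that, uniformly over all input strings, the output
entries of `N.power k` larger than about `2^(-k c)` have vanishing total mass. Every output vector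
is then majorized by one fixed vector: a spike of small mass `δ` that pays for the large entries,
and about `2^(k c)` equal entries (`exists_doublyStochastic_mulVec_spikedUniform`). Its entropy is
about `(1 - δ) k c`.

Conversely, `min_x H(p_x)` is monotone by concavity of `-t log t` (`sum_mul_shannonEntropy_le`) and
additive, so it is such an entropy and bounds both extensions. The quantum statement reduces to the
classical one, because classical majorization is realized by a mixing superchannel
(`Majorizes.toQuantum`). -/

/-! ### Shannon entropy and minimum output entropy under majorization -/

theorem shannonEntropy_eq_sum_negMulLog {Y : Type} [Fintype Y] (p : Y → ℝ) :
    shannonEntropy p = (∑ y, Real.negMulLog (p y)) / Real.log 2 := by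
  simp only [shannonEntropy, Real.negMulLog, Real.logb, Finset.sum_div, ← Finset.sum_neg_distrib]
  refine Finset.sum_congr rfl fun y _ => ?_
  ring

theorem shannonEntropy_comp_equiv {Y Y' : Type} [Fintype Y] [Fintype Y'] (e : Y ≃ Y')
    (p : Y' → ℝ) : shannonEntropy (p ∘ e) = shannonEntropy p := by
  simp only [shannonEntropy, Function.comp_apply]
  rw [e.sum_comp fun y => p y * Real.logb 2 (p y)]

namespace ClassicalChannel

variable {X Y X' Y' : Type} [Fintype Y] [Fintype Y']

theorem embed_prob_apply (N : ClassicalChannel X Y) (e : Y ↪ Y') (x : X) (y : Y) :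
    (N.embed e).prob x (e y) = N.prob x y := by
  classical
  simp [embed, e.injective.eq_iff]

theorem embed_prob_of_notMem_range (N : ClassicalChannel X Y) (e : Y ↪ Y') (x : X) {y' : Y'}
    (h : y' ∉ Set.range e) : (N.embed e).prob x y' = 0 := by
  classical
  refine Finset.sum_eq_zero fun y _ => if_neg fun hy => h ⟨y, hy⟩

theorem shannonEntropy_embed (N : ClassicalChannel X Y) (e : Y ↪ Y') (x : X) :
    shannonEntropy ((N.embed e).prob x) = shannonEntropy (N.prob x) := by
  simp only [shannonEntropy]
  congr 1
  symm
  refine Finset.sum_of_injOn e e.injective.injOn (by simp) ?_ ?_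
  · intro y' _ hy'
    rw [embed_prob_of_notMem_range _ _ _ (by simpa using hy'), zero_mul]
  · intro y _
    rw [embed_prob_apply]

/-- Jensen for `Real.negMulLog`: row sums of `D z` make the weights a probability distribution for
each output `y`, and column sums remove `D z` when the bounds are added over `y`. -/
theorem sum_mul_shannonEntropy_le [Fintype X] {Z : Type} [Fintype Z] [DecidableEq Y]
    (N : ClassicalChannel X Y)
    (S : ClassicalChannel X' (X × Z)) (D : Z → Matrix Y Y ℝ)
    (hD : ∀ z, D z ∈ doublyStochastic ℝ Y) (w : X') (p : Y → ℝ)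
    (hp : ∀ y, p y = ∑ x, ∑ z, S.prob w (x, z) * (D z *ᵥ N.prob x) y) :
    ∑ x, ∑ z, S.prob w (x, z) * shannonEntropy (N.prob x) ≤ shannonEntropy p := by
  have key : ∀ y, ∑ i : X × Z × Y, (S.prob w (i.1, i.2.1) * D i.2.1 y i.2.2) *
      Real.negMulLog (N.prob i.1 i.2.2) ≤ Real.negMulLog (p y) := by
    intro y
    have hsum : ∑ i : X × Z × Y, S.prob w (i.1, i.2.1) * D i.2.1 y i.2.2 = 1 := by
      simp only [Fintype.sum_prod_type, ← Finset.mul_sum, sum_row_of_mem_doublyStochastic (hD _),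
        mul_one]
      rw [← S.sum_eq_one w, Fintype.sum_prod_type]
    have := Real.concaveOn_negMulLog.le_map_sum (t := Finset.univ)
      (w := fun i : X × Z × Y => S.prob w (i.1, i.2.1) * D i.2.1 y i.2.2)
      (p := fun i => N.prob i.1 i.2.2)
      (fun i _ => mul_nonneg (S.nonneg _ _) (nonneg_of_mem_doublyStochastic (hD _)))
      hsum (fun i _ => N.nonneg _ _)
    refine this.trans_eq ?_
    rw [hp y]
    simp only [Fintype.sum_prod_type, smul_eq_mul, Matrix.mulVec, dotProduct, Finset.mul_sum,
      mul_assoc]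
  simp only [shannonEntropy_eq_sum_negMulLog]
  rw [le_div_iff₀ (Real.log_pos one_lt_two)]
  refine le_trans (le_of_eq ?_) (Finset.sum_le_sum fun y _ => key y)
  have hcol : ∀ x z y', ∑ y, S.prob w (x, z) * D z y y' * Real.negMulLog (N.prob x y') =
      S.prob w (x, z) * Real.negMulLog (N.prob x y') := fun x z y' => by
    rw [← Finset.sum_mul, ← Finset.mul_sum, sum_col_of_mem_doublyStochastic (hD z), mul_one]
  have hlog : Real.log 2 ≠ 0 := (Real.log_pos one_lt_two).ne'
  rw [Finset.sum_comm (s := (Finset.univ : Finset Y))]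
  simp only [Fintype.sum_prod_type, hcol]
  simp only [Finset.sum_mul, ← Finset.mul_sum, mul_assoc, div_mul_cancel₀ _ hlog]

/-- Selecting inputs and relabelling outputs is a special case of majorization. -/
theorem majorizes_of_equiv [Fintype X] {N : ClassicalChannel X Y} {M : ClassicalChannel X' Y'}
    (f : X' → X) (e : Y ≃ Y') (h : ∀ w y, M.prob w (e y) = N.prob (f w) y) :
    N.Majorizes M := by
  classical
  refine Or.inr ⟨(Fintype.card_congr e).le, e.toEmbedding, Unit, inferInstance,
    ⟨fun w i => if i.1 = f w then 1 else 0, fun w i => by split_ifs <;> simp, fun w => ?_⟩,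
    fun _ => 1, fun _ => one_mem _, ?_⟩
  · simp only [Fintype.sum_prod_type, Finset.univ_unique, Finset.sum_singleton,
      Finset.sum_ite_eq', Finset.mem_univ, if_true]
  · intro w y
    obtain ⟨y, rfl⟩ := e.surjective y
    simp [h, ← embed_prob_apply N e.toEmbedding]

theorem shannonEntropy_tensor (N : ClassicalChannel X Y) (M : ClassicalChannel X' Y')
    (x : X × X') : shannonEntropy ((N.tensor M).prob x) =
      shannonEntropy (N.prob x.1) + shannonEntropy (M.prob x.2) := by
  simp only [shannonEntropy_eq_sum_negMulLog, ← add_div, tensor, Fintype.sum_prod_type,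
    Real.negMulLog_mul, Finset.sum_add_distrib, ← Finset.sum_mul, ← Finset.mul_sum, N.sum_eq_one,
    M.sum_eq_one, one_mul]

variable [Fintype X] [Nonempty X]

theorem minOutputEntropy_le (N : ClassicalChannel X Y) (x : X) :
    minOutputEntropy X Y N ≤ shannonEntropy (N.prob x) :=
  Finset.inf'_le _ (Finset.mem_univ x)

theorem exists_minOutputEntropy_eq (N : ClassicalChannel X Y) :
    ∃ x, minOutputEntropy X Y N = shannonEntropy (N.prob x) := by
  obtain ⟨x, _, h⟩ := Finset.exists_mem_eq_inf' (Finset.univ_nonempty (α := X))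
    fun x => shannonEntropy (N.prob x)
  exact ⟨x, h⟩

theorem minOutputEntropy_unit (p : ClassicalChannel Unit Y) :
    minOutputEntropy Unit Y p = shannonEntropy (p.prob ()) := by
  obtain ⟨x, h⟩ := p.exists_minOutputEntropy_eq
  exact h

theorem minOutputEntropy_embed (N : ClassicalChannel X Y) (e : Y ↪ Y') :
    minOutputEntropy X Y' (N.embed e) = minOutputEntropy X Y N := by
  simp only [minOutputEntropy, shannonEntropy_embed]

theorem MajorizesSame.minOutputEntropy_le {N : ClassicalChannel X Y} {M : ClassicalChannel X' Y}
    (h : N.MajorizesSame M) (w : X') : minOutputEntropy X Y N ≤ shannonEntropy (M.prob w) := by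
  classical
  obtain ⟨Z, _, S, D, hD, hM⟩ := h
  refine le_trans ?_ (N.sum_mul_shannonEntropy_le S D (fun z => by convert hD z) w _ (hM w))
  calc minOutputEntropy X Y N
      = ∑ x, ∑ z, S.prob w (x, z) * minOutputEntropy X Y N := by
        simp only [← Finset.sum_mul]
        rw [← Fintype.sum_prod_type' (f := fun x z => S.prob w (x, z)), S.sum_eq_one, one_mul]
    _ ≤ _ := Finset.sum_le_sum fun x _ => Finset.sum_le_sum fun z _ =>
        mul_le_mul_of_nonneg_left (N.minOutputEntropy_le x) (S.nonneg _ _)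

theorem Majorizes.minOutputEntropy_le {N : ClassicalChannel X Y} {M : ClassicalChannel X' Y'}
    (h : N.Majorizes M) (w : X') : minOutputEntropy X Y N ≤ shannonEntropy (M.prob w) := by
  obtain ⟨-, e, h⟩ | ⟨-, e, h⟩ := h
  · rw [← shannonEntropy_embed M e]
    exact h.minOutputEntropy_le w
  · rw [← minOutputEntropy_embed N e]
    exact h.minOutputEntropy_le w

theorem minOutputEntropy_tensor [Fintype X'] [Nonempty X'] (N : ClassicalChannel X Y)
    (M : ClassicalChannel X' Y') : minOutputEntropy (X × X') (Y × Y') (N.tensor M) =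
      minOutputEntropy X Y N + minOutputEntropy X' Y' M := by
  apply le_antisymm
  · obtain ⟨x, hx⟩ := N.exists_minOutputEntropy_eq
    obtain ⟨x', hx'⟩ := M.exists_minOutputEntropy_eq
    rw [hx, hx', ← shannonEntropy_tensor N M (x, x')]
    exact minOutputEntropy_le _ _
  · obtain ⟨x, hx⟩ := (N.tensor M).exists_minOutputEntropy_eq
    rw [hx, shannonEntropy_tensor]
    exact add_le_add (N.minOutputEntropy_le _) (M.minOutputEntropy_le _)

end ClassicalChannel

/-! ### Classical channel entropies and tensor powers -/

open ClassicalChannel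

theorem exists_shannonEntropy_ne_zero :
    ∃ p : ClassicalChannel Unit Bool, shannonEntropy (p.prob ()) ≠ 0 := by
  refine ⟨⟨fun _ _ => 1 / 2, fun _ _ => by norm_num, fun _ => by norm_num⟩, ?_⟩
  have : Real.log 2 ≠ 0 := (Real.log_pos one_lt_two).ne'
  simp [shannonEntropy, Real.logb, this]

theorem isClassicalChannelEntropy_minOutputEntropy :
    IsClassicalChannelEntropy minOutputEntropy where
  nonzero := by
    obtain ⟨p, hp⟩ := exists_shannonEntropy_ne_zero
    exact ⟨Unit, Bool, inferInstance, inferInstance, inferInstance, p,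
      by rwa [minOutputEntropy_unit]⟩
  monotone X Y X' Y' _ _ _ _ _ _ N M h := by
    obtain ⟨w, hw⟩ := M.exists_minOutputEntropy_eq
    rw [hw]
    exact h.minOutputEntropy_le w
  additive X Y X' Y' _ _ _ _ _ _ N M := minOutputEntropy_tensor N M

/-- The `k`-fold tensor power of a channel has `k` times its entropy. -/
theorem IsClassicalChannelEntropy.power {H : ClassicalChannelFunction}
    (hH : IsClassicalChannelEntropy H) {X Y : Type} [Fintype X] [Nonempty X] [Fintype Y]
    (N : ClassicalChannel X Y) (k : ℕ) :
    H (Fin k → X) (Fin k → Y) (N.power k) = k * H X Y N := by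
  -- Majorization in both directions forces equality; this bridges the product types of `additive`
  -- and the function types of `power`.
  have relabel : ∀ {X Y X' Y' : Type} [Fintype X] [Nonempty X] [Fintype Y]
      [Fintype X'] [Nonempty X'] [Fintype Y'] (N : ClassicalChannel X Y)
      (M : ClassicalChannel X' Y') (f : X ≃ X') (e : Y ≃ Y')
      (_ : ∀ x y, M.prob (f x) (e y) = N.prob x y), H X Y N = H X' Y' M := by
    intro X Y X' Y' _ _ _ _ _ _ N M f e h
    apply le_antisymm
    · refine hH.monotone _ _ _ _ _ _ (majorizes_of_equiv f.symm e fun w y => ?_)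
      rw [← h, f.apply_symm_apply]
    · refine hH.monotone _ _ _ _ _ _ (majorizes_of_equiv f e.symm fun w y => ?_)
      rw [← h, e.apply_symm_apply]
  induction k with
  | zero =>
    -- The trivial channel is its own tensor square up to relabelling, so its value `h` satisfies `h
    -- = h + h`.
    have h := relabel (N.power 0) ((N.power 0).tensor (N.power 0))
      (Equiv.prodUnique _ _).symm (Equiv.prodUnique _ _).symm (fun x y => by
        simp [ClassicalChannel.tensor, ClassicalChannel.power])
    rw [hH.additive] at h
    simpa using h
  | succ k ih =>
    have h := relabel (N.tensor (N.power k)) (N.power (k + 1))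
      (Fin.consEquiv fun _ => X) (Fin.consEquiv fun _ => Y) (fun x y => by
        simp [ClassicalChannel.tensor, ClassicalChannel.power, Fin.prod_univ_succ,
          Fin.consEquiv])
    rw [← h, hH.additive, ih]
    push_cast
    ring

/-- A point mass at `y₀` majorizes everything: the pre-processing draws the message `z` with law
`N.prob x`, and the swap of `y₀` and `z` moves the mass to `z`. Hence the set is non-empty and its
supremum is non-negative. -/
theorem zero_mem_minExtensionSet {X Y : Type} [Nonempty X] [Fintype Y]
    (N : ClassicalChannel X Y) : 0 ∈ minExtensionSet N := by
  classical
  obtain ⟨x₀⟩ := ‹Nonempty X›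
  have : Nonempty Y := by
    by_contra hY
    rw [not_nonempty_iff] at hY
    simpa using N.sum_eq_one x₀
  obtain ⟨y₀⟩ := this
  let q : ClassicalChannel Unit (Fin 1) := ⟨fun _ _ => 1, by simp, by simp⟩
  let e : Fin 1 ↪ Y := ⟨fun _ => y₀, fun _ _ _ => Subsingleton.elim _ _⟩
  have hq : (q.embed e).prob () = Pi.single y₀ 1 := by
    funext y
    by_cases hy : y = y₀
    · subst hy
      rw [Pi.single_eq_same]
      exact q.embed_prob_apply e () 0
    · rw [Pi.single_eq_of_ne hy, embed_prob_of_notMem_range]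
      rintro ⟨i, rfl⟩
      exact hy rfl
  refine ⟨1, q, Or.inr ⟨?_, e, Y, inferInstance,
    ⟨fun x i => N.prob x i.2, fun _ _ => N.nonneg _ _, fun x => ?_⟩,
    fun z => (Equiv.swap y₀ z).permMatrix ℝ, fun z => ?_, ?_⟩, ?_⟩
  · exact Fintype.card_le_of_embedding e
  · simp [Fintype.sum_prod_type, N.sum_eq_one]
  · convert permMatrix_mem_doublyStochastic (R := ℝ) (σ := Equiv.swap y₀ z)
  · intro x y
    simp only [Finset.univ_unique, Finset.sum_singleton]
    rw [Finset.sum_eq_single y]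
    · rw [show (default : Unit) = () from rfl, hq, Matrix.permMatrix_mulVec]
      simp
    · intro z _ hz
      rw [show (default : Unit) = () from rfl, hq, Matrix.permMatrix_mulVec]
      rw [Function.comp_apply, Pi.single_eq_of_ne, mul_zero]
      intro h
      rw [Equiv.swap_apply_eq_iff, Equiv.swap_apply_left] at h
      exact hz h.symm
    · simp
  · simp [q, shannonEntropy]

/-! ### The maximal extension, and bounds for the minimal one -/

section Extensions

theorem shannonEntropy_mem_maxExtensionSet {X Y : Type} [Fintype X] [Fintype Y]
    (N : ClassicalChannel X Y) (x : X) :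
    shannonEntropy (N.prob x) ∈ maxExtensionSet N := by
  let e := Fintype.equivFin Y
  refine ⟨Fintype.card Y, ⟨fun _ i => N.prob x (e.symm i), fun _ _ => N.nonneg _ _, fun _ => ?_⟩,
    majorizes_of_equiv (fun _ => x) e (by simp), ?_⟩
  · rw [e.symm.sum_comp, N.sum_eq_one]
  · exact (shannonEntropy_comp_equiv e.symm (N.prob x)).symm

variable {X Y : Type} [Fintype X] [Nonempty X] [Fintype Y]

theorem isLeast_maxExtensionSet (N : ClassicalChannel X Y) :
    IsLeast (maxExtensionSet N) (minOutputEntropy X Y N) := by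
  constructor
  · obtain ⟨x, hx⟩ := N.exists_minOutputEntropy_eq
    rw [hx]
    exact shannonEntropy_mem_maxExtensionSet N x
  · rintro h ⟨n, q, hq, rfl⟩
    exact hq.minOutputEntropy_le ()

theorem minOutputEntropy_mem_upperBounds (N : ClassicalChannel X Y) :
    minOutputEntropy X Y N ∈ upperBounds (minExtensionSet N) := by
  rintro h ⟨n, q, hq, rfl⟩
  obtain ⟨x, hx⟩ := N.exists_minOutputEntropy_eq
  rw [hx, ← minOutputEntropy_unit]
  exact hq.minOutputEntropy_le x

theorem isLUB_minExtension (N : ClassicalChannel X Y) :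
    IsLUB (minExtensionSet N) (minExtension N) :=
  isLUB_csSup ⟨0, zero_mem_minExtensionSet N⟩ ⟨_, minOutputEntropy_mem_upperBounds N⟩

theorem maxExtension_eq (N : ClassicalChannel X Y) :
    maxExtension N = minOutputEntropy X Y N :=
  (isLeast_maxExtensionSet N).csInf_eq

end Extensions

/-! ### Nearly flat vectors that majorize all columns at once -/

section Flattening

/-- The probability vector with first entry `δ` whose other `M` entries are equal. -/
noncomputable def spikedUniform (M : ℕ) (hM : 0 < M) (δ : ℝ) (h₀ : 0 ≤ δ) (h₁ : δ ≤ 1) :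
    ClassicalChannel Unit (Fin (M + 1)) where
  prob _ := Fin.cons δ fun _ => (1 - δ) / M
  nonneg _ y := by
    refine Fin.cases h₀ (fun _ => ?_) y
    exact div_nonneg (sub_nonneg.2 h₁) M.cast_nonneg
  sum_eq_one _ := by
    have : (M : ℝ) ≠ 0 := by positivity
    simp only [Fin.sum_univ_succ, Fin.cons_zero, Fin.cons_succ, Finset.sum_const,
      Finset.card_univ, Fintype.card_fin, nsmul_eq_mul]
    field_simp
    ring

/-- By the grouping rule the entropy exceeds the left side by the binary entropy of `δ`, which is
dropped. -/
theorem mul_logb_le_shannonEntropy_spikedUniform {M : ℕ} (hM : 0 < M) {δ : ℝ} (h₀ : 0 ≤ δ)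
    (h₁ : δ < 1) : (1 - δ) * Real.logb 2 M ≤
      shannonEntropy ((spikedUniform M hM δ h₀ h₁.le).prob ()) := by
  have hM' : (0 : ℝ) < M := by positivity
  rw [shannonEntropy_eq_sum_negMulLog, Real.logb, ← mul_div_assoc]
  refine div_le_div_of_nonneg_right ?_ (Real.log_nonneg one_le_two)
  simp only [spikedUniform, Fin.sum_univ_succ, Fin.cons_zero, Fin.cons_succ, Finset.sum_const,
      Finset.card_univ, Fintype.card_fin, nsmul_eq_mul]
  have h2 : (M : ℝ) * Real.negMulLog ((1 - δ) / M) =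
      (1 - δ) * Real.log M + Real.negMulLog (1 - δ) := by
    rw [Real.negMulLog, Real.negMulLog, Real.log_div (sub_pos.2 h₁).ne' hM'.ne']
    field_simp
    ring
  have := Real.negMulLog_nonneg h₀ h₁.le
  have := Real.negMulLog_nonneg (sub_nonneg.2 h₁.le) (sub_le_self 1 h₀)
  linarith

open Classical in
/-- A probability vector whose entries above a threshold of order `1 / M` have total mass at
most `δ` is majorized by the spiked uniform vector. -/
theorem exists_doublyStochastic_mulVec_spikedUniform {Y : Type} [Fintype Y] {p : Y → ℝ}
    (hp : ∀ y, 0 ≤ p y) (hp₁ : ∑ y, p y = 1) {M : ℕ} (hM : 0 < M) {δ : ℝ} (h₀ : 0 < δ)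
    (h₁ : δ < 1) (hT : ∑ y with 1 - δ < (M + 2) * p y, p y ≤ δ)
    {r : ℕ} (e : Y ≃ Fin (M + 1) ⊕ Fin r) (hr : 0 < r) :
    ∃ D ∈ doublyStochastic ℝ Y,
      D *ᵥ ((spikedUniform M hM δ h₀.le h₁.le).embed
        (Function.Embedding.inl.trans e.symm.toEmbedding)).prob () = p := by
  set μ := ∑ y with 1 - δ < (M + 2) * p y, p y with hμ
  have hM' : (0 : ℝ) < M := by positivity
  have hr' : (0 : ℝ) < r := by positivity
  have hμ₀ : 0 ≤ μ := Finset.sum_nonneg fun y _ => hp y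
  have hμ₁ : 0 < 1 - μ := by linarith
  have hδ₁ : 0 < 1 - δ := by linarith
  have hcard : (Fintype.card Y : ℝ) = M + 1 + r := by
    rw [Fintype.card_congr e]; simp
  -- The matrix comes from a decomposition `p = δ a + (1 - δ) b` into probability vectors, `b` being
  -- `p` restricted to its small entries and normalized. The spike gets the column `a`, each of the
  -- `M` flat entries a column `b`, and the `r` padding entries share a column `c` that completes
  -- the row sums to one.
  obtain ⟨b, hb⟩ : ∃ b : Y → ℝ, b = fun y =>
    if 1 - δ < (M + 2) * p y then 0 else p y / (1 - μ) := ⟨_, rfl⟩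
  obtain ⟨a, ha⟩ : ∃ a : Y → ℝ, a = fun y => (p y - (1 - δ) * b y) / δ := ⟨_, rfl⟩
  obtain ⟨c, hc⟩ : ∃ c : Y → ℝ, c = fun y => (1 - a y - M * b y) / r := ⟨_, rfl⟩
  have hb₀ : ∀ y, 0 ≤ b y := fun y => by
    rw [hb]; dsimp only; split_ifs
    · exact le_rfl
    · exact div_nonneg (hp y) hμ₁.le
  have hbsum : ∑ y, b y = 1 := by
    have h := Finset.sum_filter_add_sum_filter_not Finset.univ
      (fun y => 1 - δ < (M + 2) * p y) p
    rw [hp₁, ← hμ] at h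
    rw [hb, Finset.sum_ite, Finset.sum_const_zero, zero_add, ← Finset.sum_div,
      div_eq_one_iff_eq hμ₁.ne']
    linarith
  have ha₀ : ∀ y, 0 ≤ a y := fun y => by
    rw [ha]; dsimp only
    refine div_nonneg ?_ h₀.le
    rw [hb]; dsimp only; split_ifs
    · simpa using hp y
    · rw [sub_nonneg, ← mul_div_assoc, div_le_iff₀ hμ₁, mul_comm]
      exact mul_le_mul_of_nonneg_left (by linarith) (hp y)
  have hasum : ∑ y, a y = 1 := by
    rw [ha, ← Finset.sum_div, Finset.sum_sub_distrib, ← Finset.mul_sum, hp₁, hbsum]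
    field_simp
    ring
  -- This makes `c` non-negative. On large entries `b` vanishes; on small ones `a ≤ b` and `(M + 2)
  -- * b ≤ 1`, the latter because `μ ≤ δ`.
  have hab : ∀ y, a y + M * b y ≤ 1 := fun y => by
    by_cases hy : 1 - δ < (M + 2) * p y
    · have hby : b y = 0 := by rw [hb]; exact if_pos hy
      rw [hby, mul_zero, add_zero, ← hasum]
      exact Finset.single_le_sum (fun y _ => ha₀ y) (Finset.mem_univ y)
    · have hby : b y = p y / (1 - μ) := by rw [hb]; exact if_neg hy
      have hpy : p y = b y * (1 - μ) := by rw [hby, div_mul_cancel₀ _ hμ₁.ne']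
      have hay : a y ≤ b y := by
        rw [ha]; dsimp only
        rw [div_le_iff₀ h₀, hpy]
        nlinarith [hb₀ y, mul_nonneg (mul_nonneg h₀.le hμ₀) (hb₀ y)]
      have : (M + 2) * b y ≤ 1 := by
        rw [hby, ← mul_div_assoc, div_le_one hμ₁]
        linarith
      nlinarith [hb₀ y]
  have hpab : ∀ y, a y * δ + (1 - δ) * b y = p y := fun y => by
    rw [ha]; dsimp only
    rw [div_mul_cancel₀ _ h₀.ne']
    ring
  let G : Y → Fin (M + 1) ⊕ Fin r → ℝ := fun y =>
    Sum.elim (Fin.cons (a y) fun _ => b y) fun _ => c y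
  refine ⟨Matrix.of fun y y' => G y (e y'), ?_, ?_⟩
  · rw [mem_doublyStochastic_iff_sum]
    refine ⟨fun y y' => ?_, fun y => ?_, fun y' => ?_⟩
    · rw [Matrix.of_apply]
      obtain i | i := e y'
      · refine Fin.cases ?_ (fun i => ?_) i
        · exact ha₀ y
        · exact hb₀ y
      · show 0 ≤ c y
        rw [hc]
        exact div_nonneg (by linarith [hab y]) hr'.le
    · simp only [Matrix.of_apply]
      rw [e.sum_comp (G y)]
      simp only [G, Fintype.sum_sum_type, Sum.elim_inl, Sum.elim_inr, Fin.sum_univ_succ,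
        Fin.cons_zero, Fin.cons_succ, Finset.sum_const, Finset.card_univ, Fintype.card_fin,
        nsmul_eq_mul]
      rw [hc]
      field_simp
      ring
    · simp only [Matrix.of_apply]
      obtain i | i := e y'
      · refine Fin.cases ?_ (fun i => ?_) i
        · exact hasum
        · exact hbsum
      · show ∑ y, c y = 1
        rw [hc, ← Finset.sum_div, Finset.sum_sub_distrib, Finset.sum_sub_distrib, hasum,
          ← Finset.mul_sum, hbsum, Finset.sum_const, Finset.card_univ, nsmul_eq_mul, hcard]
        field_simp
        ring
  · funext y
    simp only [Matrix.mulVec, dotProduct, Matrix.of_apply]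
    rw [← e.symm.sum_comp]
    simp only [Equiv.apply_symm_apply, Fintype.sum_sum_type]
    have h1 : ∀ i : Fin (M + 1), ((spikedUniform M hM δ h₀.le h₁.le).embed
        (Function.Embedding.inl.trans e.symm.toEmbedding)).prob () (e.symm (Sum.inl i)) =
        (spikedUniform M hM δ h₀.le h₁.le).prob () i :=
      fun i => embed_prob_apply _ (Function.Embedding.inl.trans e.symm.toEmbedding) () i
    have h2 : ∀ i : Fin r, ((spikedUniform M hM δ h₀.le h₁.le).embed
        (Function.Embedding.inl.trans e.symm.toEmbedding)).prob () (e.symm (Sum.inr i)) = 0 := by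
      refine fun i => embed_prob_of_notMem_range _ _ _ ?_
      rintro ⟨j, hj⟩
      simpa using e.symm.injective hj
    simp only [h1, h2, mul_zero, Finset.sum_const_zero, add_zero]
    simp only [G, Sum.elim_inl, Fin.sum_univ_succ, Fin.cons_zero, Fin.cons_succ, spikedUniform, Finset.sum_const,
      Finset.card_univ, Fintype.card_fin, nsmul_eq_mul]
    rw [← hpab y]
    field_simp

open Classical in
theorem mul_logb_le_minExtension {X Y : Type} [Fintype X] [Nonempty X] [Fintype Y]
    (N : ClassicalChannel X Y) {M : ℕ} (hM : 0 < M) {δ : ℝ} (h₀ : 0 < δ) (h₁ : δ < 1)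
    (hT : ∀ x, ∑ y with 1 - δ < (M + 2) * N.prob x y, N.prob x y ≤ δ) :
    (1 - δ) * Real.logb 2 M ≤ minExtension N := by
  -- The small entries carry mass at least `1 - δ` and are each at most `(1 - δ) / (M + 2)`, so
  -- there are at least `M + 2` outputs. This leaves at least one padding column.
  have hcard : M + 2 ≤ Fintype.card Y := by
    obtain ⟨x⟩ := ‹Nonempty X›
    have h := Finset.sum_filter_add_sum_filter_not Finset.univ
      (fun y => 1 - δ < (M + 2) * N.prob x y) (N.prob x)
    rw [N.sum_eq_one] at h
    have h2 : ∑ y with ¬ (1 - δ < (M + 2) * N.prob x y), N.prob x y ≤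
        ∑ y : Y, (1 - δ) / (M + 2) := by
      refine (Finset.sum_le_sum fun y hy => ?_).trans
        (Finset.sum_le_sum_of_subset_of_nonneg (Finset.filter_subset _ _) fun _ _ _ => ?_)
      · rw [le_div_iff₀ (by positivity), mul_comm]
        exact not_lt.1 (Finset.mem_filter.1 hy).2
      · exact div_nonneg (by linarith) (by positivity)
    rw [Finset.sum_const, Finset.card_univ, nsmul_eq_mul, ← mul_div_assoc] at h2
    have h3 := hT x
    have h4 : 1 - δ ≤ Fintype.card Y * (1 - δ) / (M + 2) := by linarith
    rw [le_div_iff₀ (by positivity), mul_comm] at h4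
    have h5 := le_of_mul_le_mul_right h4 (by linarith)
    exact_mod_cast h5
  have e : Y ≃ Fin (M + 1) ⊕ Fin (Fintype.card Y - (M + 1)) :=
    Fintype.equivOfCardEq (by simp; omega)
  refine (mul_logb_le_shannonEntropy_spikedUniform hM h₀.le h₁).trans
    ((isLUB_minExtension N).1 ⟨M + 1, spikedUniform M hM δ h₀.le h₁.le, ?_, rfl⟩)
  choose D hD hDp using fun x => exists_doublyStochastic_mulVec_spikedUniform (N.nonneg x)
    (N.sum_eq_one x) hM h₀ h₁ (hT x) e (by omega)
  -- The message is a copy of the input, so the doubly stochastic matrix may depend on `x` while the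
  -- majorizing vector does not.
  refine Or.inr ⟨by simp; omega, Function.Embedding.inl.trans e.symm.toEmbedding, X,
    inferInstance, ⟨fun x i => if i.2 = x then 1 else 0, fun _ _ => by split_ifs <;> simp,
    fun x => ?_⟩, D, hD, fun x y => ?_⟩
  · rw [Fintype.sum_prod_type]
    simp
  · simp [hDp]

end Flattening

/-! ### Chernoff bound for the large output probabilities -/

section Concentration

/-- Chernoff bound for the mass of the large entries of a nonnegative vector. -/
theorem sum_filter_lt_le_rpow {Y : Type} [Fintype Y] {p : Y → ℝ} (hp : ∀ y, 0 ≤ p y)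
    {t s : ℝ} (ht : 0 < t) (hs : 0 ≤ s) [DecidablePred fun y => 1 < t * p y] :
    ∑ y with 1 < t * p y, p y ≤ t ^ s * ∑ y, p y * p y ^ s := by
  rw [Finset.mul_sum]
  have : ∀ y, t ^ s * (p y * p y ^ s) = p y * (t * p y) ^ s := fun y => by
    rw [Real.mul_rpow ht.le (hp y)]
    ring
  simp only [this]
  refine (Finset.sum_le_sum fun y hy => ?_).trans
    (Finset.sum_le_sum_of_subset_of_nonneg (Finset.filter_subset _ _) fun y _ _ => ?_)
  · exact le_mul_of_one_le_right (hp y)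
      (Real.one_le_rpow (Finset.mem_filter.1 hy).2.le hs)
  · exact mul_nonneg (hp y) (Real.rpow_nonneg (mul_nonneg ht.le (hp y)) _)

/-- Multiplicativity of the moments reduces a bound over all input strings to one over single
inputs. -/
theorem sum_power_mul_rpow {X Y : Type} [Fintype Y] (N : ClassicalChannel X Y) (k : ℕ)
    (x : Fin k → X) (s : ℝ) :
    ∑ y, (N.power k).prob x y * (N.power k).prob x y ^ s =
      ∏ i, ∑ y, N.prob (x i) y * N.prob (x i) y ^ s := by
  classical
  rw [Finset.prod_univ_sum, Fintype.piFinset_univ]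
  refine Finset.sum_congr rfl fun y _ => ?_
  simp only [ClassicalChannel.power]
  rw [← Real.finsetProd_rpow _ _ fun i _ => N.nonneg _ _, Finset.prod_mul_distrib]

/-- Both sides equal 1 at `s = 0`, where their derivatives are `-H(p) log 2` and `-c log 2`; the
left one is smaller. -/
theorem eventually_sum_mul_rpow_lt {Y : Type} [Fintype Y] {p : Y → ℝ} (hp : ∀ y, 0 ≤ p y)
    (hp₁ : ∑ y, p y = 1) {c : ℝ} (hc : c < shannonEntropy p) :
    ∀ᶠ s in 𝓝[>] (0 : ℝ), ∑ y, p y * p y ^ s < 2 ^ (-(s * c)) := by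
  have hlog : 0 < Real.log 2 := Real.log_pos one_lt_two
  have h1 : HasDerivAt (fun s : ℝ => ∑ y, p y * p y ^ s) (∑ y, p y * Real.log (p y)) 0 := by
    refine HasDerivAt.fun_sum fun y _ => ?_
    obtain h | h := (hp y).eq_or_lt
    · simpa [← h] using hasDerivAt_const (0 : ℝ) (0 : ℝ)
    · simpa using ((Real.hasStrictDerivAt_const_rpow h 0).hasDerivAt.const_mul (p y))
  have h2 : HasDerivAt (fun s : ℝ => (2 : ℝ) ^ (-(s * c))) (-c * Real.log 2) 0 := by
    have h3 : HasDerivAt (fun s : ℝ => -(s * c)) (-c) 0 := by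
      simpa using ((hasDerivAt_id (0 : ℝ)).mul_const c).fun_neg
    have := h3.const_rpow (a := 2) two_pos
    simpa [mul_comm] using this
  have h3 := h1.sub h2
  have hneg : ∑ y, p y * Real.log (p y) - -c * Real.log 2 < 0 := by
    rw [shannonEntropy_eq_sum_negMulLog, lt_div_iff₀ hlog] at hc
    simp only [Real.negMulLog, neg_mul, Finset.sum_neg_distrib] at hc
    linarith
  have h4 := (hasDerivWithinAt_iff_tendsto_slope.1 (h3.hasDerivWithinAt (s := Set.Ioi 0)))
  have h5 := h4.eventually (gt_mem_nhds hneg)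
  rw [Set.sdiff_singleton_eq_self (by simp)] at h5
  filter_upwards [h5, self_mem_nhdsWithin] with s hs hs0
  rw [slope_def_field] at hs
  have hs0' : (0 : ℝ) < s := hs0
  rw [sub_zero, div_lt_iff₀ hs0', zero_mul] at hs
  simp [hp₁] at hs
  exact hs

end Concentration

/-! ### The regularized minimal extension and uniqueness -/

section Regularization

variable {X Y : Type} [Fintype X] [Nonempty X] [Fintype Y]

theorem minExtension_power_le (N : ClassicalChannel X Y) (k : ℕ) :
    minExtension (N.power k) ≤ k * minOutputEntropy X Y N := by
  rw [← isClassicalChannelEntropy_minOutputEntropy.power]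
  exact (isLUB_minExtension _).2 (minOutputEntropy_mem_upperBounds _)

/-- Take `M = 2 ^ ⌊k * c⌋₊`; the floor costs the `- 1`. An intermediate `c'` bounds the moments by
`2 ^ (-(s * c'))`, with one `s` for all of the finitely many inputs, and the gap `c' - c` makes the
mass of the large entries decay exponentially in `k`. -/
theorem eventually_le_minExtension_power (N : ClassicalChannel X Y) {c : ℝ} (hc₀ : 0 < c)
    (hc : c < minOutputEntropy X Y N) {δ : ℝ} (h₀ : 0 < δ) (h₁ : δ < 1) :
    ∀ᶠ k : ℕ in atTop, (1 - δ) * (k * c - 1) ≤ minExtension (N.power k) := by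
  classical
  obtain ⟨c', hcc', hc'⟩ := exists_between hc
  have hev : ∀ᶠ s in 𝓝[>] (0 : ℝ), ∀ x, ∑ y, N.prob x y * N.prob x y ^ s < 2 ^ (-(s * c')) :=
    eventually_all.2 fun x => eventually_sum_mul_rpow_lt (N.nonneg x) (N.sum_eq_one x)
      (hc'.trans_le (N.minOutputEntropy_le x))
  obtain ⟨s, hs, hs₀⟩ := (hev.and self_mem_nhdsWithin).exists
  have hs₀ : 0 < s := hs₀
  have hδ₁ : 0 < 1 - δ := by linarith
  -- The 3 absorbs the threshold factor: `2 ^ j + 2 ≤ 3 * 2 ^ (k * c)`.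
  have hlim : Tendsto (fun k : ℕ => (3 / (1 - δ)) ^ s * ((2 : ℝ) ^ (-(s * (c' - c)))) ^ k) atTop
      (𝓝 ((3 / (1 - δ)) ^ s * 0)) := by
    refine (tendsto_pow_atTop_nhds_zero_of_lt_one (by positivity) ?_).const_mul _
    exact Real.rpow_lt_one_of_one_lt_of_neg one_lt_two
      (neg_lt_zero.2 (mul_pos hs₀ (sub_pos.2 hcc')))
  rw [mul_zero] at hlim
  filter_upwards [hlim.eventually (gt_mem_nhds h₀)] with k hk
  have hkc : 0 ≤ k * c := by positivity
  set j := ⌊k * c⌋₊ with hj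
  have hjle : (j : ℝ) ≤ k * c := Nat.floor_le hkc
  have hjlt : k * c < j + 1 := Nat.lt_floor_add_one _
  have h2j : ((2 ^ j : ℕ) : ℝ) ≤ 2 ^ (k * c) := by
    push_cast
    rw [← Real.rpow_natCast]
    exact Real.rpow_le_rpow_of_exponent_le one_le_two hjle
  have hone : (1 : ℝ) ≤ 2 ^ (k * c) := Real.one_le_rpow one_le_two hkc
  have hkey := mul_logb_le_minExtension (N.power k) (M := 2 ^ j) (by positivity) h₀ h₁ ?_
  · refine le_trans (mul_le_mul_of_nonneg_left ?_ hδ₁.le) hkey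
    push_cast
    rw [Real.logb_pow, Real.logb_self_eq_one one_lt_two]
    linarith
  · intro x
    set t := (((2 ^ j : ℕ) : ℝ) + 2) / (1 - δ) with ht
    have ht₀ : 0 < t := by positivity
    have hiff : ∀ y, 1 - δ < (((2 ^ j : ℕ) : ℝ) + 2) * (N.power k).prob x y ↔
        1 < t * (N.power k).prob x y := fun y => by
      rw [ht, div_mul_eq_mul_div, one_lt_div hδ₁]
    simp only [hiff]
    refine (sum_filter_lt_le_rpow ((N.power k).nonneg x) ht₀ hs₀.le).trans (le_trans ?_ hk.le)
    rw [sum_power_mul_rpow]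
    have hprod : ∏ i, ∑ y, N.prob (x i) y * N.prob (x i) y ^ s ≤
        ((2 : ℝ) ^ (-(s * c'))) ^ k := by
      refine (Finset.prod_le_prod (fun i _ => Finset.sum_nonneg fun y _ =>
        mul_nonneg (N.nonneg _ _) (Real.rpow_nonneg (N.nonneg _ _) _))
        fun i _ => (hs (x i)).le).trans_eq ?_
      simp
    have htle : t ≤ 3 / (1 - δ) * 2 ^ (k * c) := by
      rw [ht, div_mul_eq_mul_div]
      exact div_le_div_of_nonneg_right (by linarith) hδ₁.le
    calc t ^ s * _ ≤ (3 / (1 - δ) * 2 ^ (k * c)) ^ s * ((2 : ℝ) ^ (-(s * c'))) ^ k := by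
          refine mul_le_mul (Real.rpow_le_rpow ht₀.le htle hs₀.le) hprod ?_ (by positivity)
          exact Finset.prod_nonneg fun i _ => Finset.sum_nonneg fun y _ =>
            mul_nonneg (N.nonneg _ _) (Real.rpow_nonneg (N.nonneg _ _) _)
      _ = _ := by
          rw [Real.mul_rpow (by positivity) (by positivity), mul_assoc, ← Real.rpow_mul two_pos.le,
            ← Real.rpow_natCast, ← Real.rpow_natCast, ← Real.rpow_mul two_pos.le,
            ← Real.rpow_mul two_pos.le, ← Real.rpow_add two_pos]
          ring_nf

theorem tendsto_minExtension_power (N : ClassicalChannel X Y) :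
    Tendsto (fun k : ℕ => (1 / (k : ℝ)) * minExtension (N.power k)) atTop
      (𝓝 (minOutputEntropy X Y N)) := by
  rw [tendsto_order]
  constructor
  · intro a ha
    obtain ha₀ | ha₀ := lt_or_ge a 0
    · refine Eventually.of_forall fun k => ha₀.trans_le (mul_nonneg (by positivity) ?_)
      exact (isLUB_minExtension _).1 (zero_mem_minExtensionSet _)
    obtain ⟨c, hac, hc⟩ := exists_between ha
    have hc₀ : 0 < c := ha₀.trans_lt hac
    -- This `δ` makes `(1 - δ) * c` the midpoint of `a` and `c`.
    have hδ₀ : 0 < (c - a) / (2 * c) := div_pos (sub_pos.2 hac) (by positivity)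
    have hδ₁ : (c - a) / (2 * c) < 1 := by
      rw [div_lt_one (by positivity)]
      linarith
    have hlim : Tendsto (fun k : ℕ => (1 - (c - a) / (2 * c)) * (c - 1 / (k : ℝ))) atTop
        (𝓝 ((1 - (c - a) / (2 * c)) * (c - 0))) :=
      (tendsto_const_nhds.sub tendsto_one_div_atTop_nhds_zero_nat).const_mul _
    have hlt : a < (1 - (c - a) / (2 * c)) * (c - 0) := by
      have : (1 - (c - a) / (2 * c)) * (c - 0) = (c + a) / 2 := by
        field_simp
        ring
      linarith
    filter_upwards [eventually_le_minExtension_power N hc₀ hc hδ₀ hδ₁,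
      hlim.eventually (lt_mem_nhds hlt), eventually_gt_atTop 0] with k h1 h2 hk
    have hk' : (0 : ℝ) < k := by exact_mod_cast hk
    refine h2.trans_le (le_of_eq_of_le ?_ (mul_le_mul_of_nonneg_left h1 (by positivity)))
    field_simp
  · intro b hb
    filter_upwards [eventually_gt_atTop 0] with k hk
    have hk' : (0 : ℝ) < k := by exact_mod_cast hk
    refine lt_of_le_of_lt ?_ hb
    rw [one_div_mul_eq_div, div_le_iff₀' hk']
    exact minExtension_power_le N k

/-- Classical channel entropies that extend the Shannon entropy are unique. -/
theorem IsClassicalChannelEntropy.eq_minOutputEntropy {H : ClassicalChannelFunction}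
    (hH : IsClassicalChannelEntropy H)
    (hS : ∀ (Y : Type) [Fintype Y] (p : ClassicalChannel Unit Y),
      H Unit Y p = shannonEntropy (p.prob ())) (N : ClassicalChannel X Y) :
    H X Y N = minOutputEntropy X Y N := by
  apply le_antisymm
  · obtain ⟨x, hx⟩ := N.exists_minOutputEntropy_eq
    rw [hx, ← hS Y ⟨fun _ => N.prob x, fun _ => N.nonneg x, fun _ => N.sum_eq_one x⟩]
    exact hH.monotone _ _ _ _ _ _
      (majorizes_of_equiv (fun _ => x) (Equiv.refl Y) fun _ _ => rfl)
  · refine le_of_tendsto (tendsto_minExtension_power N) ?_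
    filter_upwards [eventually_gt_atTop 0] with k hk
    have hk' : (0 : ℝ) < k := by exact_mod_cast hk
    rw [one_div_mul_eq_div, div_le_iff₀' hk', ← hH.power]
    -- By monotonicity the value at `N.power k` bounds the entropy of every majorizing vector.
    refine (isLUB_minExtension _).2 ?_
    rintro h ⟨n, q, hq, rfl⟩
    rw [← hS]
    exact hH.monotone _ _ _ _ _ _ hq

end Regularization

/-! ### Classical majorization as quantum majorization -/

theorem QuantumChannel.map_injective {A B : Type} [Fintype A] [Fintype B]
    {N M : QuantumChannel A B} (h : N.map = M.map) : N = M := by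
  cases N
  cases M
  congr

namespace ClassicalChannel

variable {X Y X' Y' : Type} [Fintype X] [Fintype Y] [Fintype X'] [Fintype Y']

open Classical in
theorem toLinearMap_apply (N : ClassicalChannel X Y) (ρ : Matrix X X ℂ) (y y' : Y) :
    N.toLinearMap ρ y y' = if y = y' then ∑ x, ρ x x * (N.prob x y : ℂ) else 0 := rfl

theorem toQuantum_tensor (N : ClassicalChannel X Y) (M : ClassicalChannel X' Y') :
    (N.tensor M).toQuantum = N.toQuantum.tensor M.toQuantum := by
  classical
  refine QuantumChannel.map_injective (LinearMap.ext fun ρ => Matrix.ext fun i j => ?_)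
  change (N.tensor M).toLinearMap ρ i j =
    N.toLinearMap (Matrix.of fun x x' => M.toLinearMap
      (Matrix.of fun a a' => ρ (x, a) (x', a')) i.2 j.2) i.1 j.1
  simp only [toLinearMap_apply, Matrix.of_apply, Fintype.sum_prod_type, tensor, Prod.ext_iff]
  by_cases h₁ : i.1 = j.1 <;> by_cases h₂ : i.2 = j.2
  · simp only [h₁, h₂, and_self, if_true, Finset.sum_mul]
    refine Finset.sum_congr rfl fun x _ => Finset.sum_congr rfl fun x' _ => ?_
    push_cast
    ring
  all_goals simp [h₁, h₂]

open Classical in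
/-- The isometry that sends each basis vector to the basis vector given by an embedding. -/
noncomputable def embeddingMatrix {Y Y' : Type} (e : Y ↪ Y') : Matrix Y' Y ℂ :=
  Matrix.of fun y' y => if e y = y' then 1 else 0

theorem isIsometryMatrix_embeddingMatrix {Y Y' : Type} [Fintype Y'] (e : Y ↪ Y') :
    IsIsometryMatrix (embeddingMatrix e) := by
  classical
  ext i j
  simp [embeddingMatrix, Matrix.mul_apply, Matrix.one_apply, Matrix.conjTranspose_apply,
    e.injective.eq_iff, eq_comm]

/-- Zero padding is an isometric embedding, so both branches of `Majorizes` carry over. -/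
theorem conjMap_embeddingMatrix_comp_toLinearMap (N : ClassicalChannel X Y) (e : Y ↪ Y') :
    conjMap (embeddingMatrix e) ∘ₗ N.toLinearMap = (N.embed e).toLinearMap := by
  classical
  refine LinearMap.ext fun ρ => Matrix.ext fun i j => ?_
  have h : conjMap (embeddingMatrix e) (N.toLinearMap ρ) i j =
      ∑ y, (if e y = i then (∑ x, ρ x x * (N.prob x y : ℂ)) else 0) *
        (if e y = j then 1 else 0) := by
    simp only [conjMap, LinearMap.coe_mk, AddHom.coe_mk, Matrix.mul_apply, toLinearMap_apply,
      embeddingMatrix, Matrix.conjTranspose_apply, Matrix.of_apply]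
    refine Finset.sum_congr rfl fun y _ => ?_
    by_cases h : e y = j <;> simp [h]
  rw [LinearMap.comp_apply, h, toLinearMap_apply]
  simp only [embed]
  by_cases hij : i = j
  · subst hij
    simp only [if_true, Complex.ofReal_sum, Finset.mul_sum]
    rw [Finset.sum_comm]
    refine Finset.sum_congr rfl fun y _ => ?_
    by_cases hy : e y = i <;> simp [hy]
  · rw [if_neg hij]
    refine Finset.sum_eq_zero fun y _ => ?_
    by_cases hy : e y = i
    · rw [if_neg (fun h => hij (hy.symm.trans h)), mul_zero]
    · rw [if_neg hy, zero_mul]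

variable {Z : Type} [Fintype Z]

open Classical in
/-- The isometry that writes the outcome of `S` coherently together with a copy of the input. -/
noncomputable def dilation (S : ClassicalChannel X' (X × Z)) : Matrix ((X' × X × Z) × X) X' ℂ :=
  Matrix.of fun i w =>
    if i.1.1 = w ∧ i.1.2.1 = i.2 then ((Real.sqrt (S.prob w i.1.2) : ℝ) : ℂ) else 0

theorem isIsometryMatrix_dilation (S : ClassicalChannel X' (X × Z)) :
    IsIsometryMatrix S.dilation := by
  classical
  ext w w'
  have h : ∀ w x z, ((Real.sqrt (S.prob w (x, z)) : ℝ) : ℂ) *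
      ((Real.sqrt (S.prob w (x, z)) : ℝ) : ℂ) = (S.prob w (x, z) : ℂ) := fun w x z => by
    rw [← Complex.ofReal_mul, Real.mul_self_sqrt (S.nonneg _ _)]
  simp only [Matrix.mul_apply, Matrix.conjTranspose_apply, dilation, Matrix.of_apply,
    Fintype.sum_prod_type, Matrix.one_apply]
  by_cases hw : w = w'
  · subst hw
    have hs : ∑ x, ∑ z, (S.prob w (x, z) : ℂ) = 1 := by
      have := S.sum_eq_one w
      rw [Fintype.sum_prod_type] at this
      exact_mod_cast this
    rw [if_pos rfl, ← hs, Finset.sum_eq_single w]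
    · refine Finset.sum_congr rfl fun x _ => Finset.sum_congr rfl fun z _ => ?_
      rw [Finset.sum_eq_single x]
      · simp [h]
      · intro x' _ hx'
        simp [Ne.symm hx']
      · simp
    · intro w' _ hw'
      simp [hw']
    · simp
  · rw [if_neg hw]
    refine Finset.sum_eq_zero fun v _ => Finset.sum_eq_zero fun x _ =>
      Finset.sum_eq_zero fun z _ => Finset.sum_eq_zero fun x' _ => ?_
    by_cases hv : v = w
    · subst hv
      simp [hw]
    · simp [hv]

/-- Diagonal entries suffice, since the classical post-processing reads only the diagonal of its
input. -/
theorem conjMap_dilation_apply_self (S : ClassicalChannel X' (X × Z)) [DecidableEq X]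
    (ρ : Matrix X' X' ℂ)
    (w : X') (x x' : X) (z : Z) : conjMap S.dilation ρ ((w, x, z), x') ((w, x, z), x') =
      if x = x' then (S.prob w (x, z) : ℂ) * ρ w w else 0 := by
  classical
  have h : ∀ w x z, ((Real.sqrt (S.prob w (x, z)) : ℝ) : ℂ) *
      ((Real.sqrt (S.prob w (x, z)) : ℝ) : ℂ) = (S.prob w (x, z) : ℂ) := fun w x z => by
    rw [← Complex.ofReal_mul, Real.mul_self_sqrt (S.nonneg _ _)]
  simp only [conjMap, LinearMap.coe_mk, AddHom.coe_mk, Matrix.mul_apply, dilation,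
    Matrix.conjTranspose_apply, Matrix.of_apply]
  by_cases hx : x = x'
  · subst hx
    simp only [and_true, ite_mul, zero_mul, Finset.sum_ite_eq, Finset.mem_univ, if_true]
    rw [Finset.sum_eq_single w]
    · simp only [if_true, ← h, Complex.star_def, Complex.conj_ofReal]
      ring
    · intro v _ hv
      simp [Ne.symm hv]
    · simp
  · simp [hx]

/-- The classical channel that applies a doubly stochastic matrix chosen by a message. -/
def controlled {R : Type} (D : R → Matrix Y Y ℝ) [DecidableEq Y]
    (hD : ∀ z, D z ∈ doublyStochastic ℝ Y) : ClassicalChannel (R × Y) Y where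
  prob i y := D i.1 y i.2
  nonneg _ _ := nonneg_of_mem_doublyStochastic (hD _)
  sum_eq_one _ := sum_col_of_mem_doublyStochastic (hD _) _

/-- Off-diagonal blocks in `B` vanish because the output is classical. If `N` is marginally uniform,
its diagonal blocks do not depend on the index in `B`, and averaging them with rows of sum one
changes nothing, for each register value `r`. -/
theorem isMixing_of_controlled {A A' B : Type} [Fintype A] [Fintype A'] [Fintype B]
    [DecidableEq B] (Θ : Superchannel A B A') (D : Θ.R → Matrix B B ℝ)
    (hD : ∀ r, D r ∈ doublyStochastic ℝ B) (hE : Θ.E.map = (controlled D hD).toLinearMap) :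
    Θ.IsMixing := by
  classical
  intro C₀ C₁ _ _ _ _ N hN ρ b c b' c'
  obtain ⟨σ, hσ⟩ : ∃ σ : Matrix (Θ.R × A × C₀) (Θ.R × A × C₀) ℂ,
      σ = (Matrix.reindexLinearEquiv ℂ ℂ (Equiv.prodAssoc Θ.R A C₀)
        (Equiv.prodAssoc Θ.R A C₀)) (tensorId C₀ (conjMap Θ.V) ρ) := ⟨_, rfl⟩
  have h : ∀ b c b' c', Θ.applyExt N.map ρ (b, c) (b', c') =
      if b = b' then ∑ r, ∑ d, N.map (Matrix.of fun a a' => σ (r, a) (r, a')) (d, c) (d, c') *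
        (D r b d : ℂ) else 0 := by
    intro b c b' c'
    rw [hσ]
    change Θ.E.map (Matrix.of fun i j => N.map _ (i.2, c) (j.2, c')) b b' = _
    rw [hE, toLinearMap_apply]
    simp only [Fintype.sum_prod_type]
    rfl
  have h' : ∀ b, Θ.applyExt N.map ρ (b, c) (b, c') = (Fintype.card B : ℂ)⁻¹ *
      ∑ r, ∑ d, N.map (Matrix.of fun a a' => σ (r, a) (r, a')) (d, c) (d, c') := by
    intro b
    rw [h, if_pos rfl, Finset.mul_sum]
    refine Finset.sum_congr rfl fun r _ => ?_
    have hrow : ∑ d, (D r b d : ℂ) = 1 := by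
      exact_mod_cast sum_row_of_mem_doublyStochastic (hD r) b
    have hd : ∀ d, N.map (Matrix.of fun a a' => σ (r, a) (r, a')) (d, c) (d, c') =
        (Fintype.card B : ℂ)⁻¹ *
          ∑ d, N.map (Matrix.of fun a a' => σ (r, a) (r, a')) (d, c) (d, c') :=
      fun d => (hN _ d c d c').trans (if_pos rfl)
    rw [← mul_one (_ * ∑ d, _), ← hrow, Finset.mul_sum]
    exact Finset.sum_congr rfl fun d _ => by rw [← hd d]
  split_ifs with hb
  · subst hb
    have hB : (Fintype.card B : ℂ) ≠ 0 := by
      exact_mod_cast (Fintype.card_pos_iff.2 ⟨b⟩).ne'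
    simp only [h']
    rw [Finset.sum_const, Finset.card_univ, nsmul_eq_mul, mul_inv_cancel_left₀ hB]
  · rw [h, if_neg hb]

/-- The register keeps `(w, x, z)`; the post-processing reads `z` from it and applies `D z`. -/
theorem MajorizesSame.toLinearMap {N : ClassicalChannel X Y} {M : ClassicalChannel X' Y}
    (h : N.MajorizesSame M) : QuantumMajorizesSame N.toLinearMap M.toLinearMap := by
  classical
  obtain ⟨Z, _, S, D, hD, hM⟩ := h
  have hD' : ∀ r : X' × X × Z, D r.2.2 ∈ doublyStochastic ℝ Y := fun r => by convert hD r.2.2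
  let Θ : Superchannel X Y X' :=
    { R := X' × X × Z
      V := S.dilation
      isometry := S.isIsometryMatrix_dilation
      E := (controlled (fun r : X' × X × Z => D r.2.2) hD').toQuantum }
  refine ⟨Θ, isMixing_of_controlled Θ (fun r : X' × X × Z => D r.2.2) hD' rfl,
    LinearMap.ext fun ρ => Matrix.ext fun y y' => ?_⟩
  change _ = (controlled (fun r : X' × X × Z => D r.2.2) hD').toLinearMap
    (Matrix.of fun i j => N.toLinearMap
      (Matrix.of fun x x' => conjMap S.dilation ρ (i.1, x) (j.1, x')) i.2 j.2) y y'
  simp only [toLinearMap_apply, Matrix.of_apply, Fintype.sum_prod_type,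
    conjMap_dilation_apply_self, if_true]
  split_ifs
  · refine Finset.sum_congr rfl fun w _ => ?_
    rw [hM]
    push_cast
    rw [Finset.mul_sum]
    refine Finset.sum_congr rfl fun x _ => ?_
    rw [Finset.mul_sum]
    refine Finset.sum_congr rfl fun z _ => ?_
    simp only [Matrix.mulVec, dotProduct, Complex.ofReal_sum, Complex.ofReal_mul,
      Finset.mul_sum, ite_mul, zero_mul, Finset.sum_ite_eq, Finset.mem_univ, if_true]
    refine Finset.sum_congr rfl fun b _ => ?_
    simp only [controlled]
    ring
  · rfl

theorem Majorizes.toQuantum {N : ClassicalChannel X Y} {M : ClassicalChannel X' Y'}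
    (h : N.Majorizes M) : N.toQuantum.Majorizes M.toQuantum := by
  obtain ⟨hc, e, h⟩ | ⟨hc, e, h⟩ := h
  · refine Or.inl ⟨hc, embeddingMatrix e, isIsometryMatrix_embeddingMatrix e, ?_⟩
    have := h.toLinearMap
    rwa [← conjMap_embeddingMatrix_comp_toLinearMap] at this
  · refine Or.inr ⟨hc, embeddingMatrix e, isIsometryMatrix_embeddingMatrix e, ?_⟩
    have := h.toLinearMap
    rwa [← conjMap_embeddingMatrix_comp_toLinearMap] at this

end ClassicalChannel

theorem IsChannelEntropy.isClassicalChannelEntropy {H : QuantumChannelFunction}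
    (hH : IsChannelEntropy H)
    (hS : ∀ (Y : Type) [Fintype Y] (p : ClassicalChannel Unit Y),
      H Unit Y p.toQuantum = shannonEntropy (p.prob ())) :
    IsClassicalChannelEntropy fun X Y _ _ _ N => H X Y N.toQuantum where
  -- A witness from `hH.nonzero` need not be classical, so a fair coin is used.
  nonzero := by
    obtain ⟨p, hp⟩ := exists_shannonEntropy_ne_zero
    exact ⟨Unit, Bool, inferInstance, inferInstance, inferInstance, p, by rwa [hS]⟩
  monotone X Y X' Y' _ _ _ _ _ _ N M h := hH.monotone _ _ _ _ _ _ h.toQuantum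
  additive X Y X' Y' _ _ _ _ _ _ N M := by
    rw [toQuantum_tensor, hH.additive]

theorem theorem20 :
    -- The extensions are genuine suprema and infima, and both the regularized minimal
    -- extension (the limit exists) and the maximal extension equal `min_x H(p_x)`.
    (∀ (X Y : Type) [Fintype X] [Nonempty X] [Fintype Y] (N : ClassicalChannel X Y),
      IsLUB (minExtensionSet N) (minExtension N) ∧
      IsGLB (maxExtensionSet N) (maxExtension N) ∧
      Tendsto (fun k : ℕ => (1 / (k : ℝ)) * minExtension (N.power k)) atTop
        (𝓝 (minOutputEntropy X Y N)) ∧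
      maxExtension N = minOutputEntropy X Y N) ∧
    -- Every channel entropy that reduces to Shannon entropy takes this value on every
    -- classical channel.
    (∀ H : QuantumChannelFunction, IsChannelEntropy H →
      (∀ (Y : Type) [Fintype Y] (p : ClassicalChannel Unit Y),
        H Unit Y p.toQuantum = shannonEntropy (p.prob ())) →
      ∀ (X Y : Type) [Fintype X] [Nonempty X] [Fintype Y] (N : ClassicalChannel X Y),
        H X Y N.toQuantum = minOutputEntropy X Y N) ∧
    -- On the classical domain there is exactly one such entropy.
    (∀ H : ClassicalChannelFunction,
      (IsClassicalChannelEntropy H ∧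
        ∀ (Y : Type) [Fintype Y] (p : ClassicalChannel Unit Y),
          H Unit Y p = shannonEntropy (p.prob ())) ↔
      ∀ (X Y : Type) [Fintype X] [Nonempty X] [Fintype Y] (N : ClassicalChannel X Y),
        H X Y N = minOutputEntropy X Y N) := by
  refine ⟨fun X Y _ _ _ N => ⟨isLUB_minExtension N, ?_, tendsto_minExtension_power N,
    maxExtension_eq N⟩, fun H hH hS X Y _ _ _ N => ?_, fun H => ⟨?_, fun h => ?_⟩⟩
  · rw [maxExtension_eq]
    exact (isLeast_maxExtensionSet N).isGLB
  · exact (hH.isClassicalChannelEntropy hS).eq_minOutputEntropy hS N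
  · rintro ⟨hH, hS⟩ X Y _ _ _ N
    exact hH.eq_minOutputEntropy hS N
  · obtain rfl : H = minOutputEntropy := by
      funext X Y _ _ _ N
      exact h X Y N
    exact ⟨isClassicalChannelEntropy_minOutputEntropy, fun Y _ p => minOutputEntropy_unit p⟩
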